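/- Let $M=(M_n)_{n=0}^\infty$ be a sequence of positive real numbers such that $\sum_{n=1}^\infty M_n^{-1/n}=\infty$. Let $X$ be a perfect compact subset of $\mathbb{C}$, and let $\gamma:[a,b]\to X$ (with $a<b$) be an admissible path in $X$, that is, a continuous map of finite length which is not constant on any non-degenerate closed subinterval of $[a,b]$. Write $\gamma^-=\gamma(a)$ and $\gamma^*=\gamma([a,b])$. Let $D^\infty(X)$ be the set of functions $f:X\to\mathbb{C}$ which have continuous complex derivatives $f^{(k)}:X\to\mathbb{C}$ of all orders $k$, where $f^{(0)}=f$ and, inductively, $f^{(k+1)}(x)=\lim_{z\to x,\,z\in X\setminus\{x\}}\frac{f^{(k)}(z)-f^{(k)}(x)}{z-x}$ for $x\in X$. Suppose that $f\in D^\infty(X)$ satisfies $f^{(k)}(\gamma^-)=0$ and $|f^{(k)}(z)|\le M_k$ for all $z\in\gamma^*$ and all $k=0,1,2,\dots$. Then $f(z)=0$ for all $z\in\gamma^*$. -/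

import Mathlib

open Set

/-- A path in the plane with parameter interval `[a, b]`, where `a < b`: a continuous function
`γ : [a, b] → ℂ`, represented by a function on `ℝ` whose values off `[a, b]` are irrelevant. -/
structure IsPlanePath (γ : ℝ → ℂ) (a b : ℝ) : Prop where
  lt : a < b
  continuousOn : ContinuousOn γ (Icc a b)

/-- The image of the path `γ : [a, b] → ℂ`. -/
def planePathImage (γ : ℝ → ℂ) (a b : ℝ) : Set ℂ := γ '' Icc a b

/-- A path is rectifiable if its length, the supremum of the lengths of its inscribed polygons
(the total variation), is finite. -/
def IsRectifiablePath (γ : ℝ → ℂ) (a b : ℝ) : Prop := eVariationOn γ (Icc a b) < ⊤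

/-- An admissible path: a rectifiable path none of whose subpaths, i.e. restrictions to
non-degenerate closed subintervals, is constant. -/
structure IsAdmissiblePath (γ : ℝ → ℂ) (a b : ℝ) : Prop where
  isPath : IsPlanePath γ a b
  rectifiable : IsRectifiablePath γ a b
  no_constant_subpath : ∀ c d : ℝ, a ≤ c → c < d → d ≤ b →
    ¬ ∃ w : ℂ, ∀ t ∈ Icc c d, γ t = w

/-- Membership in the algebra of `n` times continuously complex differentiable functions on a
perfect set `X`, by induction on `n`. Functions on `X` are represented by functions on `ℂ` whose
values off `X` are irrelevant; `derivWithin f X x` is the limit of `(f z - f x) / (z - x)` as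
`z → x` within `X`. For `n = 0` this is continuity, and for `n = 1` it says that `f` is complex
differentiable at each point of `X`, with a derivative that is continuous on `X`. -/
def MemContDeriv (X : Set ℂ) : ℕ → (ℂ → ℂ) → Prop
  | 0, f => ContinuousOn f X
  | n + 1, f => DifferentiableOn ℂ f X ∧ MemContDeriv X n (derivWithin f X)

/-- Membership in the algebra of functions on `X` with continuous complex derivatives of all
orders. -/
def MemContDerivInfty (X : Set ℂ) (f : ℂ → ℂ) : Prop := ∀ n : ℕ, 1 ≤ n → MemContDeriv X n f

/-- The `k`-th complex derivative of `f` on `X`: the operation `g ↦ g'` on functions on `X`,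
applied `k` times to `f`. -/
noncomputable def complexDerivOn (X : Set ℂ) : ℕ → (ℂ → ℂ) → (ℂ → ℂ)
  | 0, f => f
  | k + 1, f => complexDerivOn X k (derivWithin f X)

/-! Parametrized by arc length, the path becomes a `1`-Lipschitz `φ` on `[0, ℓ]`, and along it `g k
= f^(k) ∘ φ` is a chain: `‖g (k + 1)‖` dominates the growth rate of `‖g k‖`. This reduces the claim
to a real-variable Denjoy-Carleman theorem, `chain_eq_zero`.

Put `L n = log (max (M n) 1)`, and let `c` be the convex minorant of `L` on `{0, …, N}`, with
increasing slopes `s i`. Start from `g k 0 = 0` and traverse consecutive intervals of lengths `exp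
(-(1 + s i))`, for `i` from `N - 1` down to `m`. On the interval of index `i` a Gronwall estimate of
rate `exp (1 + s i)` loses only one factor `e`. So after these intervals `‖g k‖ ≤ exp (k - m + c k)`
for low `k`, the bound at the top of the chain coming from an index where `c = L`
(`chain_bound_of_convexMinorant`).

Carleman's inequality turns the divergence of `∑ M n ^ (-1/n)` into unboundedness, as `N` grows, of
the total length for each fixed `m`. Hence `‖g 0‖ ≤ exp (-m + L 0)` on all of `[0, ℓ]` for every `m
≥ 1`. -/

open Filter Topology in
/-- Gronwall-type propagation of geometric bounds along a chain `g 0, g 1, …` in which each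
`g (k + 1)` dominates the upper right derivative of the norm of `g k`. -/
theorem norm_le_mul_exp_of_chain {E : Type*} [NormedAddCommGroup E] {g : ℕ → ℝ → E} {s t : ℝ}
    (hc : ∀ k, ContinuousOn (g k) (Icc s t))
    (hslope : ∀ k, ∀ x ∈ Ico s t, ∀ r, ‖g (k + 1) x‖ < r →
      ∃ᶠ z in 𝓝[>] x, slope (fun y => ‖g k y‖) x z < r)
    {A : ℕ → ℝ} {ρ : ℝ} {p : ℕ} (hA : ∀ k < p, A (k + 1) ≤ ρ * A k) (hρ : 0 ≤ ρ)
    (hAp : 0 ≤ A p) (hs : ∀ k < p, ‖g k s‖ ≤ A k) (htop : ∀ x ∈ Icc s t, ‖g p x‖ ≤ A p)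
    {k : ℕ} (hk : k ≤ p) : ∀ x ∈ Icc s t, ‖g k x‖ ≤ A k * Real.exp (ρ * (x - s)) := by
  induction hk using Nat.decreasingInduction with
  | self =>
    intro x hx
    refine (htop x hx).trans (le_mul_of_one_le_right hAp (Real.one_le_exp ?_))
    exact mul_nonneg hρ (sub_nonneg.2 hx.1)
  | of_succ k hk ih =>
    have hB : ∀ x, HasDerivAt (fun x => A k * Real.exp (ρ * (x - s)))
        (ρ * A k * Real.exp (ρ * (x - s))) x := by
      intro x
      have h := ((((hasDerivAt_id x).sub_const s).const_mul ρ).exp).const_mul (A k)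
      simp only [id, mul_one] at h
      rwa [mul_comm (Real.exp _), ← mul_assoc, mul_comm (A k)] at h
    refine fun x hx => image_le_of_liminf_slope_right_le_deriv_boundary (hc k).norm
      (by simpa using hs k hk) (fun x _ => (hB x).continuousAt.continuousWithinAt)
      (fun x _ => (hB x).hasDerivWithinAt) (fun x hx r hr => hslope k x hx r ?_) hx
    refine lt_of_le_of_lt ((ih x ⟨hx.1, hx.2.le⟩).trans ?_) hr
    exact mul_le_mul_of_nonneg_right (hA k hk) (Real.exp_pos _).le

/-! ### Convex minorants of finite sequences -/

/-- One step of the construction of the largest convex minorant of `L` on `{0, …, N}`: the least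
slope from the point `(k, y)` to a later point of the graph of `L`. -/
noncomputable def leastSlope (L : ℕ → ℝ) (N k : ℕ) (y : ℝ) : ℝ :=
  -- The `max` only keeps the range nonempty; it equals `N` when `k < N`.
  (Finset.Icc (k + 1) (max N (k + 1))).inf'
    (Finset.nonempty_Icc.2 (le_max_right _ _)) (fun j => (L j - y) / ((j : ℝ) - k))

/-- The largest convex minorant of `L` on `{0, …, N}`. -/
noncomputable def convexMinorant (L : ℕ → ℝ) (N : ℕ) : ℕ → ℝ
  | 0 => L 0
  | k + 1 => convexMinorant L N k + leastSlope L N k (convexMinorant L N k)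

/-- The slopes of the largest convex minorant of `L` on `{0, …, N}`. -/
noncomputable def minorantSlope (L : ℕ → ℝ) (N k : ℕ) : ℝ :=
  leastSlope L N k (convexMinorant L N k)

theorem convexMinorant_succ (L : ℕ → ℝ) (N k : ℕ) :
    convexMinorant L N (k + 1) = convexMinorant L N k + minorantSlope L N k := rfl

theorem exists_eq_minorantSlope (L : ℕ → ℝ) {N k : ℕ} (hk : k < N) :
    ∃ j, k < j ∧ j ≤ N ∧ L j = convexMinorant L N k + ((j : ℝ) - k) * minorantSlope L N k := by
  obtain ⟨j, hj, h⟩ := Finset.exists_mem_eq_inf'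
    (Finset.nonempty_Icc.2 (le_max_right N (k + 1)))
    (fun j : ℕ => (L j - convexMinorant L N k) / ((j : ℝ) - k))
  rw [Finset.mem_Icc] at hj
  refine ⟨j, by omega, by omega, ?_⟩
  have hjk : (0 : ℝ) < (j : ℝ) - k := sub_pos.2 (by exact_mod_cast hj.1)
  rw [minorantSlope, leastSlope, h]
  field_simp
  ring

theorem minorantSlope_mul_le (L : ℕ → ℝ) {N k j : ℕ} (hkj : k < j) (hj : j ≤ N) :
    convexMinorant L N k + ((j : ℝ) - k) * minorantSlope L N k ≤ L j := by
  have hjk : (0 : ℝ) < (j : ℝ) - k := sub_pos.2 (by exact_mod_cast hkj)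
  have h : minorantSlope L N k ≤ (L j - convexMinorant L N k) / ((j : ℝ) - k) :=
    Finset.inf'_le (fun j : ℕ => (L j - convexMinorant L N k) / ((j : ℝ) - k))
      (Finset.mem_Icc.2 ⟨hkj, hj.trans (le_max_left _ _)⟩)
  rw [le_div_iff₀ hjk] at h
  linarith

theorem convexMinorant_le (L : ℕ → ℝ) {N k : ℕ} (hk : k ≤ N) : convexMinorant L N k ≤ L k := by
  cases k with
  | zero => exact le_rfl
  | succ k =>
    have h := minorantSlope_mul_le L (Nat.lt_succ_self k) hk
    rw [convexMinorant_succ]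
    push_cast at h
    linarith

theorem convexMinorant_self (L : ℕ → ℝ) (N : ℕ) : convexMinorant L N N = L N := by
  cases N with
  | zero => rfl
  | succ N =>
    obtain ⟨j, h1, h2, h⟩ := exists_eq_minorantSlope L (Nat.lt_succ_self N)
    obtain rfl : j = N + 1 := by omega
    rw [convexMinorant_succ, h]
    push_cast
    ring

theorem minorantSlope_le_succ (L : ℕ → ℝ) {N k : ℕ} (hk : k + 1 < N) :
    minorantSlope L N k ≤ minorantSlope L N (k + 1) := by
  obtain ⟨j, h1, h2, h⟩ := exists_eq_minorantSlope L hk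
  have h3 := minorantSlope_mul_le L ((Nat.lt_succ_self k).trans h1) h2
  have hj : (0 : ℝ) < (j : ℝ) - (k + 1) := sub_pos.2 (by exact_mod_cast h1)
  rw [h, convexMinorant_succ] at h3
  push_cast at h3
  nlinarith

theorem minorantSlope_mono (L : ℕ → ℝ) {N i j : ℕ} (hij : i ≤ j) (hj : j < N) :
    minorantSlope L N i ≤ minorantSlope L N j := by
  induction j, hij using Nat.le_induction with
  | base => exact le_rfl
  | succ j _ ih => exact (ih (by omega)).trans (minorantSlope_le_succ L hj)

/-- If the least slope from `k` is attained beyond `k + 1`, the same point is still available from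
`k + 1`, with the same slope: the minorant bends only where it touches `L`. -/
theorem convexMinorant_eq_or_minorantSlope_eq (L : ℕ → ℝ) {N k : ℕ} (hk : k + 1 < N) :
    convexMinorant L N (k + 1) = L (k + 1) ∨
      minorantSlope L N (k + 1) = minorantSlope L N k := by
  obtain ⟨j, h1, h2, h⟩ := exists_eq_minorantSlope L ((Nat.lt_succ_self k).trans hk)
  rcases Nat.eq_or_lt_of_le h1 with h3 | h3
  · left
    subst h3
    rw [convexMinorant_succ, h]
    push_cast
    ring
  · right
    refine le_antisymm ?_ (minorantSlope_le_succ L hk)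
    have h4 := minorantSlope_mul_le L h3 h2
    have hj : (0 : ℝ) < (j : ℝ) - (k + 1) := sub_pos.2 (by exact_mod_cast h3)
    rw [h, convexMinorant_succ] at h4
    push_cast at h4
    nlinarith

theorem convexMinorant_eq_add_sum (L : ℕ → ℝ) (N n : ℕ) :
    convexMinorant L N n = L 0 + ∑ i ∈ Finset.range n, minorantSlope L N i := by
  induction n with
  | zero => simp [convexMinorant]
  | succ n ih => rw [convexMinorant_succ, ih, Finset.sum_range_succ, add_assoc]

theorem neg_le_minorantSlope_zero {L : ℕ → ℝ} (hL : ∀ n, 0 ≤ L n) {N : ℕ} (hN : 0 < N) :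
    -L 0 ≤ minorantSlope L N 0 := by
  obtain ⟨j, h1, -, h⟩ := exists_eq_minorantSlope L hN
  have hj : (1 : ℝ) ≤ j := by exact_mod_cast h1
  have h0 : convexMinorant L N 0 = L 0 := rfl
  rw [h0] at h
  push_cast at h
  nlinarith [hL j, hL 0]

/-! ### Carleman's inequality -/

/-- Summation by parts for the weights `1 / ((n + 1) (n + 2))`. -/
theorem sum_div_mul_succ (y : ℕ → ℝ) (N : ℕ) :
    ∑ n ∈ Finset.range N, (∑ i ∈ Finset.range (n + 1), y i) / (((n : ℝ) + 1) * (n + 2)) =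
      ∑ i ∈ Finset.range N, y i / ((i : ℝ) + 1) -
        (∑ i ∈ Finset.range N, y i) / ((N : ℝ) + 1) := by
  induction N with
  | zero => simp
  | succ N ih =>
    rw [Finset.sum_range_succ, ih, Finset.sum_range_succ y, Finset.sum_range_succ _ N]
    push_cast
    field_simp
    ring

/-- Carleman's inequality for finite sums. -/
theorem sum_exp_average_le (x : ℕ → ℝ) (N : ℕ) :
    ∑ n ∈ Finset.range N, Real.exp ((∑ i ∈ Finset.range (n + 1), x i) / ((n : ℝ) + 1)) ≤
      Real.exp 1 * ∑ i ∈ Finset.range N, Real.exp (x i) := by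
  -- Pólya's weights for AM-GM: their sums telescope, and `d i ≤ 1 + log (i + 1)`, i.e. `(1 + 1 / (i
  -- + 1)) ^ (i + 1) ≤ e`.
  set d : ℕ → ℝ := fun i => ((i : ℝ) + 1) * Real.log ((i : ℝ) + 2) - i * Real.log ((i : ℝ) + 1)
    with hd
  have hdsum : ∀ n : ℕ, ∑ i ∈ Finset.range n, d i = n * Real.log ((n : ℝ) + 1) := by
    intro n
    induction n with
    | zero => simp
    | succ n ih =>
      rw [Finset.sum_range_succ, ih, hd]
      push_cast
      ring_nf
  have hamgm : ∀ n : ℕ, Real.exp ((∑ i ∈ Finset.range (n + 1), x i) / ((n : ℝ) + 1)) ≤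
      (∑ i ∈ Finset.range (n + 1), Real.exp (x i + d i)) / (((n : ℝ) + 1) * (n + 2)) := by
    intro n
    have hn : (0 : ℝ) < (n : ℝ) + 1 := by positivity
    have hn2 : (0 : ℝ) < (n : ℝ) + 2 := by positivity
    have h := convexOn_exp.map_sum_le (t := Finset.range (n + 1)) (w := fun _ => 1 / ((n : ℝ) + 1))
      (p := fun i => x i + d i) (fun _ _ => by positivity)
      (by
        rw [Finset.sum_const, Finset.card_range, nsmul_eq_mul]
        push_cast
        field_simp)
      (fun _ _ => mem_univ _)
    simp only [smul_eq_mul] at h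
    rw [← Finset.mul_sum, ← Finset.mul_sum, Finset.sum_add_distrib, hdsum] at h
    push_cast at h
    have h1 : 1 / ((n : ℝ) + 1) * (∑ i ∈ Finset.range (n + 1), x i +
        ((n : ℝ) + 1) * Real.log ((n : ℝ) + 1 + 1)) =
        (∑ i ∈ Finset.range (n + 1), x i) / ((n : ℝ) + 1) + Real.log ((n : ℝ) + 2) := by
      rw [show (n : ℝ) + 1 + 1 = n + 2 by ring]
      field_simp
    rw [h1, Real.exp_add, Real.exp_log hn2, ← le_div_iff₀ hn2] at h
    refine h.trans (le_of_eq ?_)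
    field_simp
  have hterm : ∀ i : ℕ, Real.exp (x i + d i) / ((i : ℝ) + 1) ≤ Real.exp 1 * Real.exp (x i) := by
    intro i
    have hi : (0 : ℝ) < (i : ℝ) + 1 := by positivity
    have hi2 : (0 : ℝ) < (i : ℝ) + 2 := by positivity
    have h := Real.log_le_sub_one_of_pos (div_pos hi2 hi)
    rw [Real.log_div hi2.ne' hi.ne'] at h
    have h1 : d i ≤ 1 + Real.log ((i : ℝ) + 1) := by
      have h2 := mul_le_mul_of_nonneg_left h hi.le
      have h3 : ((i : ℝ) + 1) * (((i : ℝ) + 2) / (i + 1) - 1) = 1 := by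
        field_simp
        ring
      rw [h3] at h2
      simp only [hd]
      linarith
    rw [div_le_iff₀ hi]
    calc Real.exp (x i + d i) ≤ Real.exp (x i + (1 + Real.log ((i : ℝ) + 1))) :=
          Real.exp_le_exp.2 (by linarith)
      _ = Real.exp 1 * Real.exp (x i) * ((i : ℝ) + 1) := by
          rw [Real.exp_add, Real.exp_add, Real.exp_log hi]
          ring
  calc _ ≤ _ := Finset.sum_le_sum fun n _ => hamgm n
    _ ≤ ∑ i ∈ Finset.range N, Real.exp (x i + d i) / ((i : ℝ) + 1) := by
        rw [sum_div_mul_succ]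
        exact sub_le_self _ (div_nonneg (Finset.sum_nonneg fun i _ => (Real.exp_pos _).le)
          (by positivity))
    _ ≤ _ := by
        rw [Finset.mul_sum]
        exact Finset.sum_le_sum fun i _ => hterm i

/-! ### Denjoy-Carleman for chains -/

open Filter Topology in
/-- If `g 0, g 1, …` is a chain of functions on `[0, ℓ]` vanishing at `0`, each dominating the
upper right derivative of the norm of its predecessor, with `‖g k‖ ≤ exp (L k)`, then the convex
minorant of `L` controls how fast the chain can grow. -/
theorem chain_bound_of_convexMinorant {E : Type*} [NormedAddCommGroup E] {g : ℕ → ℝ → E} {ℓ : ℝ}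
    (hc : ∀ k, ContinuousOn (g k) (Icc 0 ℓ))
    (hslope : ∀ k, ∀ x ∈ Ico 0 ℓ, ∀ r, ‖g (k + 1) x‖ < r →
      ∃ᶠ z in 𝓝[>] x, slope (fun y => ‖g k y‖) x z < r)
    {L : ℕ → ℝ} (hL : ∀ k, ∀ x ∈ Icc 0 ℓ, ‖g k x‖ ≤ Real.exp (L k)) (h0 : ∀ k, g k 0 = 0)
    (N : ℕ) {m : ℕ} (hm : m ≤ N) :
    ∃ p, m ≤ p ∧ p ≤ N ∧ convexMinorant L N p = L p ∧
      (∀ i, m ≤ i → i < p → minorantSlope L N i = minorantSlope L N m) ∧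
      ∀ x ∈ Icc 0 ℓ, x ≤ ∑ i ∈ Finset.Ico m N, Real.exp (-(1 + minorantSlope L N i)) →
        ∀ k < p, ‖g k x‖ ≤ Real.exp ((k : ℝ) - m + convexMinorant L N k) := by
  induction hm using Nat.decreasingInduction with
  | self =>
    refine ⟨N, le_rfl, le_rfl, convexMinorant_self L N, fun i h1 h2 => by omega, ?_⟩
    intro x hx hxN k _
    obtain rfl : x = 0 := le_antisymm (by simpa using hxN) hx.1
    rw [h0, norm_zero]
    exact (Real.exp_pos _).le
  | of_succ m hm ih =>
    obtain ⟨p, hmp, hpN, hp, hconst, hbd⟩ := ih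
    -- A contact index `q > m` with constant slope on `[m, q)`: either `m + 1`, or the `p` of the
    -- previous stage, since without contact at `m + 1` the slope does not change there.
    obtain ⟨q, hmq, hqp, hq, hqconst⟩ : ∃ q, m + 1 ≤ q ∧ q ≤ p ∧ convexMinorant L N q = L q ∧
        ∀ i, m ≤ i → i < q → minorantSlope L N i = minorantSlope L N m := by
      by_cases h : convexMinorant L N (m + 1) = L (m + 1)
      · refine ⟨m + 1, le_rfl, hmp, h, fun i h1 h2 => ?_⟩
        rw [show i = m by omega]
      · have hne : m + 1 ≠ p := by
          rintro rfl
          exact h hp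
        have hs := (convexMinorant_eq_or_minorantSlope_eq L (by omega)).resolve_left h
        refine ⟨p, hmp, le_rfl, hp, fun i h1 h2 => ?_⟩
        rcases Nat.eq_or_lt_of_le h1 with h3 | h3
        · rw [h3]
        · rw [hconst i h3 h2, hs]
    refine ⟨q, by omega, hqp.trans hpN, hq, hqconst, ?_⟩
    intro x hx hxm k hk
    set τ := ∑ i ∈ Finset.Ico (m + 1) N, Real.exp (-(1 + minorantSlope L N i)) with hτ
    rw [Finset.sum_eq_sum_Ico_succ_bot hm, ← hτ] at hxm
    have hτ0 : 0 ≤ τ := Finset.sum_nonneg fun i _ => (Real.exp_pos _).le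
    have hs0 : 0 ≤ min x τ := le_min hx.1 hτ0
    have hsub : Icc (min x τ) ℓ ⊆ Icc 0 ℓ := Icc_subset_Icc_left hs0
    -- Start at `min x τ`, where the previous stage applies; the remaining length is at most `1 /
    -- ρ`, so the growth is at most `e`.
    have key := norm_le_mul_exp_of_chain (fun k => (hc k).mono hsub)
      (fun k y hy => hslope k y (Ico_subset_Ico_left hs0 hy))
      (A := fun k => Real.exp ((k : ℝ) - (m + 1) + convexMinorant L N k))
      (ρ := Real.exp (1 + minorantSlope L N m)) (p := q) ?_ (Real.exp_pos _).le
      (Real.exp_pos _).le ?_ ?_ hk.le x ⟨min_le_left _ _, hx.2⟩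
    · refine key.trans ?_
      rw [← Real.exp_add, Real.exp_le_exp]
      have h1 : x - min x τ ≤ Real.exp (-(1 + minorantSlope L N m)) := by
        rcases min_cases x τ with h | h
        · rw [h.1, sub_self]
          exact (Real.exp_pos _).le
        · rw [h.1]
          linarith
      have h2 := mul_le_mul_of_nonneg_left h1 (Real.exp_pos (1 + minorantSlope L N m)).le
      rw [← Real.exp_add, add_neg_cancel, Real.exp_zero] at h2
      linarith
    · intro j hj
      have h1 : minorantSlope L N j ≤ minorantSlope L N m := by
        rcases le_total j m with h | h
        · exact minorantSlope_mono L h hm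
        · exact (hqconst j h hj).le
      rw [← Real.exp_add, Real.exp_le_exp, convexMinorant_succ]
      push_cast
      linarith
    · intro j hj
      have h1 := hbd (min x τ) ⟨hs0, (min_le_left _ _).trans hx.2⟩ (min_le_right _ _) j
        (hj.trans_le hqp)
      push_cast at h1
      exact h1
    · intro y hy
      refine (hL q y (hsub hy)).trans (Real.exp_le_exp.2 ?_)
      have h1 : ((m + 1 : ℕ) : ℝ) ≤ q := by exact_mod_cast hmq
      push_cast at h1
      rw [hq]
      linarith

-- If the capped series converged, its terms would eventually be below `1`, hence uncapped.
-- Replacing `M` by `max M 1` caps `M n ^ (-1/n)` in this way.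
open Filter in
theorem tendsto_sum_min_one {u : ℕ → ℝ} (hu : ∀ n, 0 ≤ u n)
    (h : Tendsto (fun N => ∑ n ∈ Finset.range N, u n) atTop atTop) :
    Tendsto (fun N => ∑ n ∈ Finset.range N, min (u n) 1) atTop atTop := by
  rw [← not_summable_iff_tendsto_nat_atTop_of_nonneg (fun n => le_min (hu n) zero_le_one)]
  rw [← not_summable_iff_tendsto_nat_atTop_of_nonneg hu] at h
  refine fun hs => h ((summable_congr_atTop ?_).1 hs)
  filter_upwards [hs.tendsto_atTop_zero.eventually (gt_mem_nhds zero_lt_one)] with n hn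
  exact min_eq_left_of_lt (by simpa using hn)

/-- The lengths of the steps on which a chain is controlled by the convex minorants of `L` have
divergent sums. -/
theorem exists_le_sum_exp_neg_minorantSlope {L : ℕ → ℝ} (hL : ∀ n, 0 ≤ L n)
    (hdiv : Filter.Tendsto (fun N => ∑ n ∈ Finset.range N, Real.exp (-(L (n + 1) / ((n : ℝ) + 1))))
      Filter.atTop Filter.atTop) (m : ℕ) (ℓ : ℝ) :
    ∃ N, m ≤ N ∧ ℓ ≤ ∑ i ∈ Finset.Ico m N, Real.exp (-(1 + minorantSlope L N i)) := by
  -- One `e` is lost in Carleman's inequality, one in the step lengths; `m * exp (L 0)` covers the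
  -- first `m` terms, as `s i ≥ s 0 ≥ -L 0`.
  obtain ⟨N, hN1, hN⟩ := ((Filter.eventually_gt_atTop m).and (hdiv.eventually_ge_atTop
    (Real.exp 1 * (Real.exp 1 * ℓ + m * Real.exp (L 0))))).exists
  refine ⟨N, hN1.le, ?_⟩
  have h1 := sum_exp_average_le (fun i => -minorantSlope L N i) N
  have h2 : ∑ n ∈ Finset.range N, Real.exp (-(L (n + 1) / ((n : ℝ) + 1))) ≤
      ∑ n ∈ Finset.range N,
        Real.exp ((∑ i ∈ Finset.range (n + 1), -minorantSlope L N i) / ((n : ℝ) + 1)) := by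
    refine Finset.sum_le_sum fun n hn => Real.exp_le_exp.2 ?_
    rw [← neg_div]
    have h3 := convexMinorant_le L (N := N) (k := n + 1) (Finset.mem_range.1 hn)
    rw [convexMinorant_eq_add_sum] at h3
    rw [Finset.sum_neg_distrib]
    have := hL 0
    gcongr
    linarith
  have h3 : Real.exp 1 * ℓ + m * Real.exp (L 0) ≤
      ∑ i ∈ Finset.range N, Real.exp (-minorantSlope L N i) :=
    le_of_mul_le_mul_left (hN.trans (h2.trans h1)) (Real.exp_pos 1)
  rw [← Finset.sum_range_add_sum_Ico _ hN1.le] at h3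
  have h4 : ∑ i ∈ Finset.range m, Real.exp (-minorantSlope L N i) ≤ m * Real.exp (L 0) := by
    rw [← nsmul_eq_mul]
    have h5 := Finset.sum_le_card_nsmul (Finset.range m)
      (fun i => Real.exp (-minorantSlope L N i)) (Real.exp (L 0)) ?_
    · rwa [Finset.card_range] at h5
    · intro i hi
      have h6 := minorantSlope_mono L (Nat.zero_le i) ((Finset.mem_range.1 hi).trans hN1)
      have h7 := neg_le_minorantSlope_zero hL (Nat.zero_lt_of_lt hN1)
      exact Real.exp_le_exp.2 (by linarith)
  have h5 : ∑ i ∈ Finset.Ico m N, Real.exp (-(1 + minorantSlope L N i)) =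
      (Real.exp 1)⁻¹ * ∑ i ∈ Finset.Ico m N, Real.exp (-minorantSlope L N i) := by
    rw [Finset.mul_sum]
    refine Finset.sum_congr rfl fun i _ => ?_
    rw [← Real.exp_neg, ← Real.exp_add]
    ring_nf
  rw [h5, ← div_eq_inv_mul, le_div_iff₀ (Real.exp_pos 1)]
  linarith

open Filter Topology in
/-- The Denjoy-Carleman theorem for chains of functions of a real variable. -/
theorem chain_eq_zero {E : Type*} [NormedAddCommGroup E] {g : ℕ → ℝ → E} {ℓ : ℝ}
    (hc : ∀ k, ContinuousOn (g k) (Icc 0 ℓ))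
    (hslope : ∀ k, ∀ x ∈ Ico 0 ℓ, ∀ r, ‖g (k + 1) x‖ < r →
      ∃ᶠ z in 𝓝[>] x, slope (fun y => ‖g k y‖) x z < r)
    {M : ℕ → ℝ} (hMpos : ∀ n, 0 < M n)
    (hMsum : Tendsto (fun N : ℕ => ∑ n ∈ Finset.Icc 1 N, (M n) ^ (-(1 / (n : ℝ)))) atTop atTop)
    (hM : ∀ k, ∀ x ∈ Icc 0 ℓ, ‖g k x‖ ≤ M k) (h0 : ∀ k, g k 0 = 0) :
    ∀ x ∈ Icc 0 ℓ, g 0 x = 0 := by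
  set L : ℕ → ℝ := fun n => Real.log (max (M n) 1) with hLdef
  have hexp : ∀ n, Real.exp (L n) = max (M n) 1 := fun n =>
    Real.exp_log (lt_max_of_lt_right one_pos)
  have hL : ∀ n, 0 ≤ L n := fun n => Real.log_nonneg (le_max_right _ _)
  have hdiv : Tendsto (fun N => ∑ n ∈ Finset.range N, Real.exp (-(L (n + 1) / ((n : ℝ) + 1))))
      atTop atTop := by
    have h1 := tendsto_sum_min_one (u := fun n => M (n + 1) ^ (-(1 / ((n : ℝ) + 1))))
      (fun n => Real.rpow_nonneg (hMpos _).le _) (hMsum.congr fun N => by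
        rw [← Finset.Ico_add_one_right_eq_Icc, Finset.sum_Ico_eq_sum_range]
        simp [add_comm])
    refine h1.congr fun N => Finset.sum_congr rfl fun n _ => ?_
    have hn : -(1 / ((n : ℝ) + 1)) ≤ 0 := by
      rw [neg_nonpos]
      positivity
    have h2 : Real.exp (-(L (n + 1) / ((n : ℝ) + 1))) =
        max (M (n + 1)) 1 ^ (-(1 / ((n : ℝ) + 1))) := by
      rw [← hexp, ← Real.exp_mul]
      ring_nf
    rw [h2]
    rcases le_total (M (n + 1)) 1 with h | h
    · rw [max_eq_right h, Real.one_rpow,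
        min_eq_right (Real.one_le_rpow_of_pos_of_le_one_of_nonpos (hMpos _) h hn)]
    · rw [max_eq_left h, min_eq_left (Real.rpow_le_one_of_one_le_of_nonpos h hn)]
  intro x hx
  rw [← norm_le_zero_iff]
  have hlim : Tendsto (fun m : ℕ => Real.exp (-(m : ℝ) + L 0)) atTop (𝓝 0) :=
    Real.tendsto_exp_atBot.comp
      (tendsto_atBot_add_const_right _ _ (tendsto_neg_atTop_atBot.comp tendsto_natCast_atTop_atTop))
  refine ge_of_tendsto hlim ?_
  filter_upwards [eventually_gt_atTop 0] with m hm
  obtain ⟨N, hmN, hN⟩ := exists_le_sum_exp_neg_minorantSlope hL hdiv m x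
  obtain ⟨p, hmp, -, -, -, hp⟩ := chain_bound_of_convexMinorant hc hslope
    (fun k y hy => (hM k y hy).trans ((le_max_left _ _).trans (hexp k).ge)) h0 N hmN
  have h := hp x hx hN 0 (hm.trans_le hmp)
  simpa [convexMinorant] using h

/-! ### Reduction to chains by arc length -/

/-- A rectifiable path has a `1`-Lipschitz parametrization. -/
theorem exists_lipschitzOnWith_parametrization {E : Type*} [MetricSpace E] {γ : ℝ → E} {a b : ℝ}
    (hab : a ≤ b) (hγ : ContinuousOn γ (Icc a b)) (hvar : eVariationOn γ (Icc a b) < ⊤) :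
    ∃ (ℓ : ℝ) (φ : ℝ → E), 0 ≤ ℓ ∧ LipschitzOnWith 1 φ (Icc 0 ℓ) ∧ φ 0 = γ a ∧
      φ '' Icc 0 ℓ = γ '' Icc a b := by
  have hbv : LocallyBoundedVariationOn γ (Icc a b) :=
    BoundedVariationOn.locallyBoundedVariationOn hvar.ne
  have ha : a ∈ Icc a b := left_mem_Icc.2 hab
  have hb : b ∈ Icc a b := right_mem_Icc.2 hab
  set V := variationOnFromTo γ (Icc a b) a with hV
  have hVa : V a = 0 := variationOnFromTo.self γ _ a
  have hmono : MonotoneOn V (Icc a b) := variationOnFromTo.monotoneOn hbv ha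
  -- The one-sided jumps of `V` equal those of `γ`, hence vanish; so `V` takes every value in `[0, V
  -- b]`.
  have hcont : ContinuousOn V (Icc a b) := by
    intro x hx
    have hl := variationOnFromTo.tendsto_left ha hx hbv
      ((hγ x hx).mono_left (nhdsWithin_mono _ inter_subset_left))
    have hr := variationOnFromTo.tendsto_right ha hx hbv
      ((hγ x hx).mono_left (nhdsWithin_mono _ inter_subset_left))
    rw [dist_self] at hl hr
    rw [sub_zero] at hl
    rw [add_zero] at hr
    have hx' : ContinuousWithinAt V {x} x := continuousWithinAt_singleton
    refine ((ContinuousWithinAt.union hl hx').union hr).mono fun y hy => ?_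
    rcases lt_trichotomy y x with h | h | h
    · exact Or.inl (Or.inl ⟨hy, h⟩)
    · exact Or.inl (Or.inr h)
    · exact Or.inr ⟨hy, h⟩
  have himg : V '' Icc a b = Icc 0 (V b) := by
    refine Subset.antisymm ?_ ?_
    · rintro _ ⟨x, hx, rfl⟩
      exact ⟨hVa ▸ hmono ha hx hx.1, hmono hx hb hx.2⟩
    · rw [← hVa]
      exact intermediate_value_Icc hab hcont
  have hφ : ∀ x ∈ Icc a b, naturalParameterization γ (Icc a b) a (V x) = γ x := fun x hx =>
    edist_eq_zero.1 (edist_naturalParameterization_eq_zero hbv ha hx)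
  refine ⟨V b, naturalParameterization γ (Icc a b) a, hVa ▸ hmono ha hb hab, ?_, ?_, ?_⟩
  · have h := has_unit_speed_naturalParameterization γ hbv ha
    rw [← hV, himg] at h
    intro x hx y hy
    wlog hxy : x ≤ y generalizing x y
    · rw [edist_comm, edist_comm x]
      exact this hy hx (le_of_not_ge hxy)
    refine (eVariationOn.edist_le _ (s := Icc 0 (V b) ∩ Icc x y) ⟨hx, le_rfl, hxy⟩
      ⟨hy, hxy, le_rfl⟩).trans ?_
    rw [h hx hy, NNReal.coe_one, one_mul, ENNReal.coe_one, one_mul, edist_comm, edist_dist,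
      Real.dist_eq, abs_of_nonneg (sub_nonneg.2 hxy)]
  · rw [← hVa, hφ a ha]
  · rw [← himg, image_image]
    exact image_congr hφ

theorem complexDerivOn_succ (X : Set ℂ) (k : ℕ) (f : ℂ → ℂ) :
    complexDerivOn X (k + 1) f = derivWithin (complexDerivOn X k f) X := by
  induction k generalizing f with
  | zero => rfl
  | succ k ih => exact ih (derivWithin f X)

theorem MemContDeriv.differentiableOn_complexDerivOn {X : Set ℂ} {k : ℕ} {f : ℂ → ℂ}
    (hf : MemContDeriv X (k + 1) f) : DifferentiableOn ℂ (complexDerivOn X k f) X := by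
  induction k generalizing f with
  | zero => exact hf.1
  | succ k ih => exact ih hf.2

open Filter Topology in
/-- Along a `1`-Lipschitz curve, the norm of the complex derivative dominates the upper right
derivative of the norm of the function. -/
theorem eventually_slope_norm_lt {X : Set ℂ} {F : ℂ → ℂ} (hF : DifferentiableOn ℂ F X)
    {φ : ℝ → ℂ} {s t : ℝ} (hφ : LipschitzOnWith 1 φ (Icc s t)) (hX : MapsTo φ (Icc s t) X)
    {x r : ℝ} (hx : x ∈ Ico s t) (hr : ‖derivWithin F X (φ x)‖ < r) :
    ∀ᶠ z in 𝓝[>] x, slope (fun y => ‖F (φ y)‖) x z < r := by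
  have hx' : x ∈ Icc s t := ⟨hx.1, hx.2.le⟩
  obtain ⟨q, hq1, hq2⟩ := exists_between hr
  have hmem : ∀ᶠ z in 𝓝[>] x, z ∈ Icc s t :=
    mem_of_superset (Ioo_mem_nhdsGT hx.2) fun z hz => ⟨hx.1.trans hz.1.le, hz.2.le⟩
  have hle : 𝓝[>] x ≤ 𝓝[Icc s t] x := by
    rw [nhdsWithin, nhdsWithin]
    exact le_inf inf_le_left (le_principal_iff.2 hmem)
  have hlim : Tendsto φ (𝓝[>] x) (𝓝[X] φ x) :=
    tendsto_nhdsWithin_iff.2 ⟨(hφ.continuousOn x hx').mono_left hle, hmem.mono fun z hz => hX hz⟩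
  have hd := (hF (φ x) (hX hx')).hasDerivWithinAt.hasFDerivWithinAt.isLittleO
  have hb := hlim.eventually (hd.bound (sub_pos.2 hq1))
  filter_upwards [hb, hmem, self_mem_nhdsWithin] with z hz hzm hxz
  have hxz : 0 < z - x := sub_pos.2 hxz
  have hL : ‖φ z - φ x‖ ≤ z - x := by
    have := hφ.dist_le_mul z hzm x hx'
    rwa [NNReal.coe_one, one_mul, dist_eq_norm, Real.dist_eq, abs_of_pos hxz] at this
  rw [slope_def_field, div_lt_iff₀ hxz]
  have h1 : ‖F (φ z)‖ ≤ ‖F (φ z) - F (φ x) - (φ z - φ x) • derivWithin F X (φ x)‖ +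
      ‖F (φ x)‖ + ‖(φ z - φ x) • derivWithin F X (φ x)‖ := by
    refine le_trans (le_of_eq ?_) (norm_add₃_le)
    congr 1
    abel
  rw [norm_smul] at h1
  have hz' : ‖F (φ z) - F (φ x) - (φ z - φ x) • derivWithin F X (φ x)‖ ≤
      (q - ‖derivWithin F X (φ x)‖) * ‖φ z - φ x‖ := by simpa using hz
  have hq0 : 0 ≤ q := (norm_nonneg _).trans hq1.le
  calc ‖F (φ z)‖ - ‖F (φ x)‖ ≤ q * ‖φ z - φ x‖ := by linarith
    _ ≤ q * (z - x) := mul_le_mul_of_nonneg_left hL hq0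
    _ < r * (z - x) := mul_lt_mul_of_pos_right hq2 hxz

theorem mainTheorem4 (M : ℕ → ℝ) (hMpos : ∀ n, 0 < M n)
    (hMsum : Filter.Tendsto
      (fun N : ℕ => ∑ n ∈ Finset.Icc 1 N, (M n) ^ (-(1 / (n : ℝ)))) Filter.atTop Filter.atTop)
    (X : Set ℂ) (hXcompact : IsCompact X) (hXperfect : Perfect X)
    (a b : ℝ) (γ : ℝ → ℂ) (hγ : IsAdmissiblePath γ a b) (hγX : planePathImage γ a b ⊆ X)
    (f : ℂ → ℂ) (hf : MemContDerivInfty X f)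
    (hzero : ∀ k : ℕ, complexDerivOn X k f (γ a) = 0)
    (hbound : ∀ k : ℕ, ∀ z ∈ planePathImage γ a b, ‖complexDerivOn X k f z‖ ≤ M k) :
    ∀ z ∈ planePathImage γ a b, f z = 0 := by
  obtain ⟨ℓ, φ, hℓ, hLip, hφ0, himg⟩ := exists_lipschitzOnWith_parametrization hγ.isPath.lt.le
    hγ.isPath.continuousOn hγ.rectifiable
  have hmem : ∀ x ∈ Icc 0 ℓ, φ x ∈ planePathImage γ a b := fun x hx =>
    himg.subset (mem_image_of_mem φ hx)
  have hmaps : MapsTo φ (Icc 0 ℓ) X := fun x hx => hγX (hmem x hx)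
  have hdiff : ∀ k, DifferentiableOn ℂ (complexDerivOn X k f) X := fun k =>
    (hf (k + 1) (Nat.le_add_left 1 k)).differentiableOn_complexDerivOn
  have key := chain_eq_zero (g := fun k x => complexDerivOn X k f (φ x))
    (fun k => (hdiff k).continuousOn.comp hLip.continuousOn hmaps)
    (fun k x hx r hr => (eventually_slope_norm_lt (hdiff k) hLip hmaps hx
      (by rwa [← complexDerivOn_succ])).frequently)
    hMpos hMsum (fun k x hx => hbound k _ (hmem x hx)) (fun k => by rw [hφ0, hzero])
  intro z hz
  obtain ⟨x, hx, rfl⟩ := himg.superset hz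
  exact key x hx
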